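/- There is a universal constant $c>0$ such that for all integers $d\ge 2$ and $T\ge d$ there is a (single-context) Bayesian linear bandit task with decision set in the Euclidean unit ball of $\mathbb{R}^d$ on which every algorithm has Bayesian regret at least $c\sqrt{dT}$ after $T$ rounds; in particular, for any algorithm there is such a task on which its regret is $\Omega(\sqrt{dT})$. Here such a task consists of a nonempty compact decision set $\Pi\subseteq\mathbb{B}_2^d=\{x\in\mathbb{R}^d:\|x\|_2\le 1\}$, a compact set $\Theta\subseteq\mathbb{R}^d$ of models, a prior $P$, which is a Borel probability measure on $\Theta$, and for all $\theta\in\Theta$, $\pi\in\Pi$ a reward distribution $R_\theta(\pi)$ on $[0,1]$, depending measurably on $(\theta,\pi)$, whose mean is the linear function $\mu_\theta(\pi)=\langle\theta,\pi\rangle$ of the decision. A model $\theta\sim P$ is drawn before the game. In each round $t=1,\dots,T$ the algorithm draws a decision $\pi_t\in\Pi$ from a distribution that depends (measurably) only on $t$ and on the past decisions and rewards $\pi_1,r_1,\dots,\pi_{t-1},r_{t-1}$; then it observes the reward $r_t\sim R_\theta(\pi_t)$. The algorithm may depend on the whole task, the prior included, and on $T$. Its Bayesian regret is $$\mathbb{E}\Big[\sum_{t=1}^T\Big(\max_{\pi\in\Pi}\mu_\theta(\pi)-r_t\Big)\Big],$$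 the expectation being over $\theta\sim P$, the decisions and the rewards. -/

import Mathlib

open MeasureTheory ProbabilityTheory

noncomputable section

namespace BayesDecision

/-- A Bayesian interactive decision-making task with contextual information, with decision space `Dec`,
model space `Mod`, context space `Ctx` and observation space `Obs`. The prior on `Mod × Ctx` is given
by its marginal on models and the conditional law of the context given the model. Given the model, the
context and the decision, `feedback` is the joint law of the observation and of the reward, and the
reward lies in `[0, 1]`. -/
structure Task (Dec Mod Ctx Obs : Type*) [MeasurableSpace Dec] [MeasurableSpace Mod]
    [MeasurableSpace Ctx] [MeasurableSpace Obs] where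
  modelPrior : Measure Mod
  isProb_modelPrior : IsProbabilityMeasure modelPrior
  contextLaw : Kernel Mod Ctx
  isMarkov_contextLaw : IsMarkovKernel contextLaw
  feedback : Kernel (Mod × (Ctx × Dec)) (Obs × unitInterval)
  isMarkov_feedback : IsMarkovKernel feedback

attribute [instance] Task.isProb_modelPrior Task.isMarkov_contextLaw Task.isMarkov_feedback

/-- A (randomized) algorithm: in round `t` (rounds are counted from `0`) it chooses the law of its
decision from the `t` past triples (context, decision, observation) and the current context. -/
structure Algorithm (Dec Ctx Obs : Type*) [MeasurableSpace Dec] [MeasurableSpace Ctx]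
    [MeasurableSpace Obs] where
  decide : (t : ℕ) → Kernel ((Fin t → Ctx × (Dec × Obs)) × Ctx) Dec
  isMarkov_decide : ∀ t, IsMarkovKernel (decide t)

attribute [instance] Algorithm.isMarkov_decide

/-- Everything that is generated in one round: ((context, decision), (observation, reward)). -/
abbrev Round (Dec Ctx Obs : Type*) : Type _ := (Ctx × Dec) × (Obs × unitInterval)

/-- The history of `t` rounds as the agent sees it. -/
def history {Dec Ctx Obs : Type*} {t : ℕ} (h : Fin t → Round Dec Ctx Obs) :
    Fin t → Ctx × (Dec × Obs) :=
  fun i => ((h i).1.1, ((h i).1.2, (h i).2.1))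

variable {Dec Mod Ctx Obs : Type*} [MeasurableSpace Dec] [MeasurableSpace Mod]
  [MeasurableSpace Ctx] [MeasurableSpace Obs]

theorem measurable_history {t : ℕ} :
    Measurable (history : (Fin t → Round Dec Ctx Obs) → Fin t → Ctx × (Dec × Obs)) := by
  unfold history
  fun_prop

/-- The law of round `t`, given the model and the previous rounds: the context is drawn given the model
(independently of the past), the decision is drawn by the algorithm, and the observation and the reward
are drawn given the model, the context and the decision. -/
def roundLaw (τ : Task Dec Mod Ctx Obs) (A : Algorithm Dec Ctx Obs) (t : ℕ) :
    Kernel (Mod × (Fin t → Round Dec Ctx Obs)) (Round Dec Ctx Obs) :=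
  (τ.contextLaw.comap (fun x : Mod × (Fin t → Round Dec Ctx Obs) => x.1) measurable_fst ⊗ₖ
      (A.decide t).comap
        (fun x : (Mod × (Fin t → Round Dec Ctx Obs)) × Ctx => (history x.1.2, x.2))
        ((measurable_history.comp (measurable_snd.comp measurable_fst)).prodMk measurable_snd)) ⊗ₖ
    τ.feedback.comap
      (fun x : (Mod × (Fin t → Round Dec Ctx Obs)) × (Ctx × Dec) => (x.1.1, x.2))
      ((measurable_fst.comp measurable_fst).prodMk measurable_snd)

/-- The joint law of the model and of the first `t` rounds of the game. -/
def gameLaw (τ : Task Dec Mod Ctx Obs) (A : Algorithm Dec Ctx Obs) :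
    (t : ℕ) → Measure (Mod × (Fin t → Round Dec Ctx Obs))
  | 0 => τ.modelPrior.map (fun m => (m, fun i => i.elim0))
  | t + 1 => (gameLaw τ A t ⊗ₘ roundLaw τ A t).map (fun x => (x.1.1, Fin.snoc x.1.2 x.2))

/-- The mean reward `μ_m(π, c)` of the decision `π` under the model `m` and the context `c`. -/
def Task.meanReward (τ : Task Dec Mod Ctx Obs) (m : Mod) (π : Dec) (c : Ctx) : ℝ :=
  ∫ x, (x.2 : ℝ) ∂τ.feedback (m, (c, π))

/-- The mean reward of the best decision under the model `m` and the context `c`. -/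
def Task.optimalReward (τ : Task Dec Mod Ctx Obs) (m : Mod) (c : Ctx) : ℝ :=
  ⨆ π : Dec, τ.meanReward m π c

/-- The Bayesian regret of the algorithm `A` on the task `τ` after `T` rounds. -/
def bayesianRegret (τ : Task Dec Mod Ctx Obs) (A : Algorithm Dec Ctx Obs) (T : ℕ) : ℝ :=
  ∫ x, ∑ t : Fin T, (τ.optimalReward x.1 (x.2 t).1.1 - ((x.2 t).2.2 : ℝ)) ∂gameLaw τ A T

/-- A (non-contextual) linear bandit on a set `D` of decisions in `ℝ^d`: the models are the parameter
vectors `θ ∈ Θ`, the mean reward of the decision `π` is `⟨θ, π⟩`, and the observation is the reward. -/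
structure IsLinearBandit {d : ℕ} {D Θ : Set (EuclideanSpace ℝ (Fin d))}
    (τ : Task D Θ Unit unitInterval) : Prop where
  meanReward_eq : ∀ (θ : Θ) (π : D) (c : Unit),
    τ.meanReward θ π c = inner ℝ (θ : EuclideanSpace ℝ (Fin d)) (π : EuclideanSpace ℝ (Fin d))
  obs_eq_reward : ∀ (θ : Θ) (π : D) (c : Unit), ∀ᵐ x ∂τ.feedback (θ, (c, π)), x.1 = x.2

end BayesDecision

end

/-!
The hard task is a bandit with `d` independent arms, which is linear when the decisions are the
standard basis vectors. One arm, uniformly distributed under the prior, gives Bernoulli rewards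
with mean `1 / 2 + ε`, and all the others give fair coin flips; the models are the vectors with
coordinates `1 / 2` except for one coordinate `1 / 2 + ε`. The regret is `ε` times the expected
number of rounds in which the good arm is missed (`bayesianRegret_hiddenArmTask`), so it is enough
that with `ε = √(d / T) / 16` no algorithm takes the good arm in more than `3 T / 4` rounds on
average.

This is shown by comparison with a reference game in which all the rewards are fair coin flips.
There the play is independent of the model, so the good arm is taken in `T / d ≤ T / 2` rounds on
average (`integral_hitCount_fairLaw`). The law of the actual game has a density `L` with respect
to the reference law. The algorithm cancels from `L`, which is a product over the rounds of
factors that differ from `1` only where the good arm is taken (`gameLaw_eq_withDensity`). Hence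
the mean of `-log L` in the reference game is of the order of `ε ^ 2` times the expected number of
such rounds, that is, of `ε ^ 2 * (T / d)`, a small constant (`integral_sum_log_likelihood`).

A small mean of `-log L` forces `L` to be close to `1` in `L¹`. Instead of Pinsker's inequality
the proof integrates the elementary pointwise bound `|x - 1| ≤ 8 (x - 1 - log x) + (x + 1) / 16`
(`abs_sub_one_le_log`), which handles all the models at once (`integral_hitCount_gameLaw_le`).
-/

noncomputable section

namespace BayesDecision

/-! ### Integration against the law of the game -/

section Game

variable {Dec Mod Ctx Obs : Type*} [MeasurableSpace Dec] [MeasurableSpace Mod]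
  [MeasurableSpace Ctx] [MeasurableSpace Obs]

theorem measurable_fin_snoc {α : Type*} [MeasurableSpace α] {t : ℕ} :
    Measurable (fun x : (Fin t → α) × α => (Fin.snoc x.1 x.2 : Fin (t + 1) → α)) := by
  refine measurable_pi_iff.2 fun i => ?_
  refine Fin.lastCases ?_ (fun j => ?_) i
  · simpa using measurable_snd
  · simpa [Function.comp_def] using (measurable_pi_apply j).comp measurable_fst

theorem measurable_extend {t : ℕ} :
    Measurable (fun x : (Mod × (Fin t → Round Dec Ctx Obs)) × Round Dec Ctx Obs =>
      (x.1.1, (Fin.snoc x.1.2 x.2 : Fin (t + 1) → Round Dec Ctx Obs))) :=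
  (measurable_fst.comp measurable_fst).prodMk
    (measurable_fin_snoc.comp ((measurable_snd.comp measurable_fst).prodMk measurable_snd))

instance isMarkovKernel_roundLaw (τ : Task Dec Mod Ctx Obs) (A : Algorithm Dec Ctx Obs) (t : ℕ) :
    IsMarkovKernel (roundLaw τ A t) := by
  unfold roundLaw
  infer_instance

instance isProbabilityMeasure_gameLaw (τ : Task Dec Mod Ctx Obs) (A : Algorithm Dec Ctx Obs)
    (t : ℕ) : IsProbabilityMeasure (gameLaw τ A t) := by
  induction t with
  | zero =>
    exact Measure.isProbabilityMeasure_map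
      (measurable_id.prodMk measurable_const).aemeasurable
  | succ t ih => exact Measure.isProbabilityMeasure_map measurable_extend.aemeasurable

theorem lintegral_roundLaw (τ : Task Dec Mod Ctx Obs) (A : Algorithm Dec Ctx Obs) {t : ℕ} (m : Mod)
    (h : Fin t → Round Dec Ctx Obs) {f : Round Dec Ctx Obs → ENNReal} (hf : Measurable f) :
    ∫⁻ y, f y ∂roundLaw τ A t (m, h) =
      ∫⁻ c, ∫⁻ π, ∫⁻ z, f ((c, π), z) ∂τ.feedback (m, (c, π)) ∂A.decide t (history h, c)
        ∂τ.contextLaw m := by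
  unfold roundLaw
  rw [Kernel.lintegral_compProd _ _ _ hf, Kernel.lintegral_compProd]
  · rfl
  · exact hf.lintegral_kernel_prod_right'' (η := τ.feedback.comap
      (fun x : (Mod × (Fin t → Round Dec Ctx Obs)) × (Ctx × Dec) => (x.1.1, x.2))
      ((measurable_fst.comp measurable_fst).prodMk measurable_snd))

theorem lintegral_gameLaw_succ (τ : Task Dec Mod Ctx Obs) (A : Algorithm Dec Ctx Obs) (t : ℕ)
    {f : Mod × (Fin (t + 1) → Round Dec Ctx Obs) → ENNReal} (hf : Measurable f) :
    ∫⁻ x, f x ∂gameLaw τ A (t + 1) =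
      ∫⁻ x, ∫⁻ y, f (x.1, Fin.snoc x.2 y) ∂roundLaw τ A t x ∂gameLaw τ A t := by
  rw [gameLaw, lintegral_map hf measurable_extend]
  exact Measure.lintegral_compProd (hf.comp measurable_extend)

/-- If, given the model, the context and the decision, a bounded function of the round has mean
zero, then so has its sum over all the rounds of the game. -/
theorem integral_sum_eq_zero (τ : Task Dec Mod Ctx Obs) (A : Algorithm Dec Ctx Obs) (T : ℕ)
    {g : Mod × Round Dec Ctx Obs → ℝ} (hg : Measurable g) {C : ℝ} (hC : ∀ x, ‖g x‖ ≤ C)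
    (h0 : ∀ m c π, ∫ z, g (m, ((c, π), z)) ∂τ.feedback (m, (c, π)) = 0) :
    ∫ x, ∑ t : Fin T, g (x.1, x.2 t) ∂gameLaw τ A T = 0 := by
  have hround : ∀ (t : ℕ) (x : Mod × (Fin t → Round Dec Ctx Obs)),
      ∫ y, g (x.1, y) ∂roundLaw τ A t x = 0 := by
    intro t x
    have hI : Integrable (fun y => g (x.1, y)) (roundLaw τ A t x) :=
      Integrable.of_bound (hg.comp (measurable_const.prodMk measurable_id)).aestronglyMeasurable C
        (Filter.Eventually.of_forall fun y => hC _)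
    unfold roundLaw at hI ⊢
    rw [ProbabilityTheory.integral_compProd hI]
    simp [Kernel.comap_apply, h0]
  induction T with
  | zero => simp
  | succ T ih =>
    have hgm : ∀ (t : ℕ) (i : Fin t), Measurable
        (fun x : Mod × (Fin t → Round Dec Ctx Obs) => g (x.1, x.2 i)) := fun t i =>
      hg.comp (measurable_fst.prodMk ((measurable_pi_apply i).comp measurable_snd))
    have hF : Measurable (fun x : Mod × (Fin (T + 1) → Round Dec Ctx Obs) =>
        ∑ t, g (x.1, x.2 t)) := Finset.measurable_sum _ fun i _ => hgm _ i
    have hlast : Measurable (fun x : (Mod × (Fin T → Round Dec Ctx Obs)) × Round Dec Ctx Obs =>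
        g (x.1.1, x.2)) :=
      hg.comp ((measurable_fst.comp measurable_fst).prodMk measurable_snd)
    have hfirst : Measurable (fun x : Mod × (Fin T → Round Dec Ctx Obs) =>
        ∑ t, g (x.1, x.2 t)) := Finset.measurable_sum _ fun i _ => hgm _ i
    have hsum : ∀ x : Mod × (Fin T → Round Dec Ctx Obs), ‖∑ t, g (x.1, x.2 t)‖ ≤ T * C := fun x =>
      (norm_sum_le_of_le _ fun t _ => hC _).trans_eq (by simp)
    rw [gameLaw, integral_map measurable_extend.aemeasurable hF.aestronglyMeasurable]
    simp only [Fin.sum_univ_castSucc, Fin.snoc_castSucc, Fin.snoc_last]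
    rw [integral_add, Measure.integral_compProd, Measure.integral_compProd]
    · simp [hround, ih]
    · exact Integrable.of_bound hlast.aestronglyMeasurable C
        (Filter.Eventually.of_forall fun y => hC _)
    · exact Integrable.of_bound (hfirst.comp measurable_fst).aestronglyMeasurable (T * C)
        (Filter.Eventually.of_forall fun y => hsum y.1)
    · exact Integrable.of_bound (hfirst.comp measurable_fst).aestronglyMeasurable (T * C)
        (Filter.Eventually.of_forall fun y => hsum y.1)
    · exact Integrable.of_bound hlast.aestronglyMeasurable C
        (Filter.Eventually.of_forall fun y => hC _)

/-- The law of the first `t` rounds of the game on a task with a single model. -/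
def playLaw (τ₀ : Task Dec Unit Ctx Obs) (A : Algorithm Dec Ctx Obs) (t : ℕ) :
    Measure (Fin t → Round Dec Ctx Obs) :=
  (gameLaw τ₀ A t).map Prod.snd

instance isProbabilityMeasure_playLaw (τ₀ : Task Dec Unit Ctx Obs) (A : Algorithm Dec Ctx Obs)
    (t : ℕ) : IsProbabilityMeasure (playLaw τ₀ A t) :=
  Measure.isProbabilityMeasure_map measurable_snd.aemeasurable

theorem lintegral_playLaw_succ (τ₀ : Task Dec Unit Ctx Obs) (A : Algorithm Dec Ctx Obs) (t : ℕ)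
    {f : (Fin (t + 1) → Round Dec Ctx Obs) → ENNReal} (hf : Measurable f) :
    ∫⁻ h, f h ∂playLaw τ₀ A (t + 1) =
      ∫⁻ h, ∫⁻ y, f (Fin.snoc h y) ∂roundLaw τ₀ A t ((), h) ∂playLaw τ₀ A t := by
  have hI : Measurable fun h => ∫⁻ y, f (Fin.snoc h y) ∂roundLaw τ₀ A t ((), h) :=
    (hf.comp measurable_fin_snoc).lintegral_kernel_prod_right'
      (κ := (roundLaw τ₀ A t).comap (fun h => ((), h)) (measurable_const.prodMk measurable_id))
  rw [playLaw, lintegral_map hf measurable_snd, playLaw, lintegral_map hI measurable_snd]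
  exact lintegral_gameLaw_succ τ₀ A t (hf.comp measurable_snd)

/-- If the feedback under the model `m` has density `ℓ (m, ·)` with respect to the feedback of a
task with a single model, then the same density relates the laws of one round, given the past. -/
theorem lintegral_roundLaw_density {τ : Task Dec Mod Ctx Obs} {τ₀ : Task Dec Unit Ctx Obs}
    (A : Algorithm Dec Ctx Obs) {ℓ : Mod × Round Dec Ctx Obs → ENNReal} (hℓ : Measurable ℓ)
    (hctx : ∀ m, τ.contextLaw m = τ₀.contextLaw ())
    (hfb : ∀ m c π, τ.feedback (m, (c, π)) =
      (τ₀.feedback ((), (c, π))).withDensity fun z => ℓ (m, ((c, π), z)))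
    {t : ℕ} (m : Mod) (h : Fin t → Round Dec Ctx Obs) {f : Round Dec Ctx Obs → ENNReal}
    (hf : Measurable f) :
    ∫⁻ y, f y ∂roundLaw τ A t (m, h) = ∫⁻ y, ℓ (m, y) * f y ∂roundLaw τ₀ A t ((), h) := by
  have hℓm : Measurable fun y => ℓ (m, y) := hℓ.comp (measurable_const.prodMk measurable_id)
  refine Eq.trans ?_ (lintegral_roundLaw τ₀ A () h (hℓm.mul hf)).symm
  rw [lintegral_roundLaw τ A m h hf, hctx]
  refine lintegral_congr fun c => lintegral_congr fun π => ?_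
  rw [hfb]
  exact lintegral_withDensity_eq_lintegral_mul _ (hℓm.comp measurable_prodMk_left)
    (hf.comp measurable_prodMk_left)

/-- Change of measure: the algorithm contributes nothing to the likelihood ratio, so the density
of the law of the game, with respect to the product of the prior and the law of a reference game
in which the model has no influence, is the product of the densities of the feedbacks. -/
theorem gameLaw_eq_withDensity {τ : Task Dec Mod Ctx Obs} {τ₀ : Task Dec Unit Ctx Obs}
    (A : Algorithm Dec Ctx Obs) {ℓ : Mod × Round Dec Ctx Obs → ENNReal} (hℓ : Measurable ℓ)
    (hctx : ∀ m, τ.contextLaw m = τ₀.contextLaw ())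
    (hfb : ∀ m c π, τ.feedback (m, (c, π)) =
      (τ₀.feedback ((), (c, π))).withDensity fun z => ℓ (m, ((c, π), z))) (t : ℕ) :
    gameLaw τ A t = (τ.modelPrior.prod (playLaw τ₀ A t)).withDensity
      fun x => ∏ s, ℓ (x.1, x.2 s) := by
  have hL : ∀ t : ℕ, Measurable
      (fun x : Mod × (Fin t → Round Dec Ctx Obs) => ∏ s, ℓ (x.1, x.2 s)) := fun t =>
    Finset.measurable_prod _ fun i _ =>
      hℓ.comp (measurable_fst.prodMk ((measurable_pi_apply i).comp measurable_snd))
  induction t with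
  | zero =>
    refine Measure.ext_of_lintegral _ fun f hf => ?_
    have hm : Measurable fun m : Mod =>
        ((m, fun i => i.elim0) : Mod × (Fin 0 → Round Dec Ctx Obs)) :=
      measurable_id.prodMk measurable_const
    rw [lintegral_withDensity_eq_lintegral_mul _ (hL 0) hf, gameLaw, lintegral_map hf hm]
    simp only [Finset.univ_eq_empty, Finset.prod_empty, Pi.mul_apply, one_mul]
    rw [lintegral_prod _ hf.aemeasurable]
    refine lintegral_congr fun m => ?_
    have : ∀ h : Fin 0 → Round Dec Ctx Obs, f (m, h) = f (m, fun i => i.elim0) := fun h => by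
      congr 2
      exact Subsingleton.elim _ _
    simp [this]
  | succ t ih =>
    refine Measure.ext_of_lintegral _ fun f hf => ?_
    have hΦ : Measurable fun x : Mod × (Fin t → Round Dec Ctx Obs) =>
        ∫⁻ y, f (x.1, Fin.snoc x.2 y) ∂roundLaw τ A t x :=
      (hf.comp measurable_extend).lintegral_kernel_prod_right'
    have hLf : Measurable fun x : Mod × (Fin (t + 1) → Round Dec Ctx Obs) =>
        (∏ s, ℓ (x.1, x.2 s)) * f x := (hL (t + 1)).mul hf
    rw [lintegral_gameLaw_succ τ A t hf, ih, lintegral_withDensity_eq_lintegral_mul _ (hL t) hΦ,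
      lintegral_withDensity_eq_lintegral_mul _ (hL (t + 1)) hf,
      lintegral_prod _ ((hL t).mul hΦ).aemeasurable]
    refine Eq.trans ?_ (lintegral_prod _ hLf.aemeasurable).symm
    refine lintegral_congr fun m => ?_
    have hsec : Measurable fun h : Fin (t + 1) → Round Dec Ctx Obs =>
        (∏ s, ℓ (m, h s)) * f (m, h) := hLf.comp (measurable_const.prodMk measurable_id)
    refine Eq.trans ?_ (lintegral_playLaw_succ τ₀ A t hsec).symm
    refine lintegral_congr fun h => ?_
    have hfh : Measurable fun y => f (m, (Fin.snoc h y : Fin (t + 1) → Round Dec Ctx Obs)) :=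
      hf.comp (measurable_const.prodMk
        (measurable_fin_snoc.comp (measurable_const.prodMk measurable_id)))
    have hℓm : Measurable fun y => ℓ (m, y) := hℓ.comp (measurable_const.prodMk measurable_id)
    simp only [Pi.mul_apply, Fin.prod_univ_castSucc, Fin.snoc_castSucc, Fin.snoc_last, mul_assoc]
    rw [lintegral_roundLaw_density A hℓ hctx hfb m h hfh]
    exact (lintegral_const_mul _ (hℓm.mul hfh)).symm

end Game

/-! ### Bandits with Bernoulli rewards -/

/-- The law of a Bernoulli reward with mean `p`, recorded twice: as the observation and as the
reward. -/
def coin (p : unitInterval) : Measure (unitInterval × unitInterval) :=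
  ENNReal.ofReal p • Measure.dirac (1, 1) + ENNReal.ofReal (1 - p) • Measure.dirac (0, 0)

theorem lintegral_coin (p : unitInterval) (f : unitInterval × unitInterval → ENNReal) :
    ∫⁻ z, f z ∂coin p = ENNReal.ofReal p * f (1, 1) + ENNReal.ofReal (1 - p) * f (0, 0) := by
  simp [coin]

theorem integral_coin (p : unitInterval) (f : unitInterval × unitInterval → ℝ) :
    ∫ z, f z ∂coin p = p * f (1, 1) + (1 - p) * f (0, 0) := by
  have hI : ∀ (a : ℝ) (z : unitInterval × unitInterval),
      Integrable f (ENNReal.ofReal a • Measure.dirac z) := fun a z =>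
    (integrable_dirac (by simp)).smul_measure ENNReal.ofReal_ne_top
  rw [coin, integral_add_measure (hI _ _) (hI _ _)]
  simp [ENNReal.toReal_ofReal, p.2.1, p.2.2]

instance isProbabilityMeasure_coin (p : unitInterval) : IsProbabilityMeasure (coin p) where
  measure_univ := by
    simp [coin, ← ENNReal.ofReal_add p.2.1 (sub_nonneg.2 p.2.2)]

theorem measurable_coin : Measurable coin := by
  refine Measure.measurable_of_measurable_coe _ fun s _ => ?_
  simp only [coin, Measure.add_apply, Measure.smul_apply, smul_eq_mul]
  fun_prop

/-- The bandit in which the reward of the decision `π` under the model `m` is Bernoulli with mean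
`p (m, π)`, and the reward is observed. -/
def bernoulliTask {Dec Mod : Type*} [MeasurableSpace Dec] [MeasurableSpace Mod] (ν : Measure Mod)
    [IsProbabilityMeasure ν] (p : Mod × Dec → unitInterval) (hp : Measurable p) :
    Task Dec Mod Unit unitInterval where
  modelPrior := ν
  isProb_modelPrior := inferInstance
  contextLaw := Kernel.const _ (Measure.dirac ())
  isMarkov_contextLaw := inferInstance
  feedback :=
    { toFun := fun x => coin (p (x.1, x.2.2))
      measurable' := measurable_coin.comp
        (hp.comp (measurable_fst.prodMk (measurable_snd.comp measurable_snd))) }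
  isMarkov_feedback := ⟨fun _ => isProbabilityMeasure_coin _⟩

section Bernoulli

variable {Dec Mod : Type*} [MeasurableSpace Dec] [MeasurableSpace Mod] (ν : Measure Mod)
  [IsProbabilityMeasure ν] {p : Mod × Dec → unitInterval} (hp : Measurable p)

theorem bernoulliTask_feedback (m : Mod) (c : Unit) (π : Dec) :
    (bernoulliTask ν p hp).feedback (m, (c, π)) = coin (p (m, π)) := rfl

theorem bernoulliTask_meanReward (m : Mod) (π : Dec) (c : Unit) :
    (bernoulliTask ν p hp).meanReward m π c = p (m, π) := by
  rw [Task.meanReward, bernoulliTask_feedback, integral_coin]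
  simp

theorem bernoulliTask_obs_eq_reward (m : Mod) (π : Dec) (c : Unit) :
    ∀ᵐ x ∂(bernoulliTask ν p hp).feedback (m, (c, π)), x.1 = x.2 := by
  rw [bernoulliTask_feedback, coin, ae_add_measure_iff]
  constructor <;> exact Measure.ae_smul_measure ((ae_dirac_iff (measurableSet_eq_fun
    measurable_fst measurable_snd)).2 rfl) _

end Bernoulli

/-! ### The hidden arm -/

section HiddenArm

variable {Dec Mod : Type*}

open Classical in
/-- Whether the decision `x.2` is the good one under the model `x.1`: `1` if so, and `0` if not. -/
def hit (arm : Mod ≃ Dec) (x : Mod × Dec) : ℝ := if arm x.1 = x.2 then 1 else 0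

theorem hit_eq_zero_or_one (arm : Mod ≃ Dec) (x : Mod × Dec) : hit arm x = 0 ∨ hit arm x = 1 := by
  unfold hit
  split_ifs <;> simp

theorem hit_nonneg (arm : Mod ≃ Dec) (x : Mod × Dec) : 0 ≤ hit arm x := by
  rcases hit_eq_zero_or_one arm x with h | h <;> simp [h]

theorem hit_le_one (arm : Mod ≃ Dec) (x : Mod × Dec) : hit arm x ≤ 1 := by
  rcases hit_eq_zero_or_one arm x with h | h <;> simp [h]

theorem hit_self (arm : Mod ≃ Dec) (m : Mod) : hit arm (m, arm m) = 1 := by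
  simp [hit]

/-- Each decision is the good one under exactly one model. -/
theorem sum_hit [Fintype Mod] (arm : Mod ≃ Dec) (π : Dec) : ∑ m, hit arm (m, π) = 1 := by
  classical
  simp [hit, ← Equiv.eq_symm_apply]

/-- The mean rewards of the hidden-arm bandit: `1 / 2 + ε` for the good decision, and `1 / 2` for
the others. -/
def hiddenMean (arm : Mod ≃ Dec) {ε : ℝ} (hε : ε ∈ Set.Icc (0 : ℝ) (1 / 4)) (x : Mod × Dec) :
    unitInterval :=
  ⟨1 / 2 + ε * hit arm x, by
    have := hε.1
    have := hε.2
    rcases hit_eq_zero_or_one arm x with h | h <;> rw [h] <;> constructor <;> linarith⟩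

/-- The likelihood ratio of one round of the hidden-arm bandit against fair coin flips: a function
of the model and the round that is affine in the reward, and `1` unless the good decision was
taken. -/
def likelihood (arm : Mod ≃ Dec) (ε : ℝ) (x : Mod × Round Dec Unit unitInterval) : ℝ :=
  1 + 2 * ε * (2 * x.2.2.2 - 1) * hit arm (x.1, x.2.1.2)

theorem likelihood_mem_Icc (arm : Mod ≃ Dec) {ε : ℝ} (hε : ε ∈ Set.Icc (0 : ℝ) (1 / 4))
    (x : Mod × Round Dec Unit unitInterval) : likelihood arm ε x ∈ Set.Icc (1 / 2 : ℝ) 2 := by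
  obtain ⟨h0, h1⟩ := hε
  have hr0 := x.2.2.2.2.1
  have hr1 := x.2.2.2.2.2
  unfold likelihood
  rcases hit_eq_zero_or_one arm (x.1, x.2.1.2) with h | h <;> rw [h] <;>
    constructor <;> nlinarith

theorem abs_log_likelihood_le (arm : Mod ≃ Dec) {ε : ℝ} (hε : ε ∈ Set.Icc (0 : ℝ) (1 / 4))
    (x : Mod × Round Dec Unit unitInterval) : |Real.log (likelihood arm ε x)| ≤ 1 := by
  obtain ⟨h0, h1⟩ := likelihood_mem_Icc arm hε x
  have hpos : 0 < likelihood arm ε x := by linarith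
  have hinv : (likelihood arm ε x)⁻¹ ≤ 2 := by
    rw [inv_le_comm₀ hpos two_pos]
    linarith
  rw [abs_le]
  constructor
  · linarith [Real.one_sub_inv_le_log_of_pos hpos]
  · linarith [Real.log_le_sub_one_of_pos hpos]

/-- The relative entropy of a fair coin with respect to a coin with mean `1 / 2 + ε`. -/
def coinEntropy (ε : ℝ) : ℝ := -((Real.log (1 + 2 * ε) + Real.log (1 - 2 * ε)) / 2)

theorem coinEntropy_le {ε : ℝ} (hε : ε ∈ Set.Icc (0 : ℝ) (1 / 4)) : coinEntropy ε ≤ 4 * ε ^ 2 := by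
  obtain ⟨h0, h1⟩ := hε
  have hsq : 0 < 1 - 4 * ε ^ 2 := by nlinarith
  have hinv : (1 - 4 * ε ^ 2)⁻¹ ≤ 1 + 8 * ε ^ 2 := by
    rw [inv_le_iff_one_le_mul₀ hsq]
    nlinarith [mul_nonneg (sq_nonneg ε) (show 0 ≤ 1 / 16 - ε ^ 2 by nlinarith)]
  have hlog : Real.log (1 + 2 * ε) + Real.log (1 - 2 * ε) = Real.log (1 - 4 * ε ^ 2) := by
    rw [← Real.log_mul (by linarith) (by linarith)]
    ring_nf
  rw [coinEntropy, hlog]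
  linarith [Real.one_sub_inv_le_log_of_pos hsq]

/-- Given the model and the decision, the logarithm of the likelihood ratio has, under fair coin
flips, the mean `-coinEntropy ε` if the decision is the good one, and `0` otherwise. -/
theorem integral_log_likelihood (arm : Mod ≃ Dec) (ε : ℝ) {p : unitInterval} (hp : (p : ℝ) = 1 / 2)
    (m : Mod) (c : Unit) (π : Dec) :
    ∫ z, (Real.log (likelihood arm ε (m, ((c, π), z))) + coinEntropy ε * hit arm (m, π)) ∂coin p
      = 0 := by
  rw [integral_coin, hp]
  rcases hit_eq_zero_or_one arm (m, π) with h | h <;> simp only [likelihood, h]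
  · simp
  · simp only [coinEntropy, Set.Icc.coe_one, Set.Icc.coe_zero]
    ring_nf

theorem coin_hiddenMean_eq_withDensity [MeasurableSpace Dec] [MeasurableSpace Mod]
    (arm : Mod ≃ Dec) {ε : ℝ} (hε : ε ∈ Set.Icc (0 : ℝ) (1 / 4)) {p : unitInterval}
    (hp : (p : ℝ) = 1 / 2) (m : Mod) (c : Unit) (π : Dec) :
    coin (hiddenMean arm hε (m, π)) =
      (coin p).withDensity fun z => ENNReal.ofReal (likelihood arm ε (m, ((c, π), z))) := by
  have hl : Measurable fun z => ENNReal.ofReal (likelihood arm ε (m, ((c, π), z))) := by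
    simp only [likelihood]
    fun_prop
  refine Measure.ext_of_lintegral _ fun f hf => ?_
  rw [lintegral_withDensity_eq_lintegral_mul _ hl hf, lintegral_coin, lintegral_coin, hp]
  simp only [Pi.mul_apply, ← mul_assoc]
  rw [← ENNReal.ofReal_mul (by norm_num), ← ENNReal.ofReal_mul (by norm_num)]
  congr 3
  all_goals simp [hiddenMean, likelihood]; ring_nf

/-- The number of times that the good decision of the model was taken. -/
def hitCount (arm : Mod ≃ Dec) {T : ℕ} (x : Mod × (Fin T → Round Dec Unit unitInterval)) : ℝ :=
  ∑ t, hit arm (x.1, (x.2 t).1.2)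

theorem hitCount_nonneg (arm : Mod ≃ Dec) {T : ℕ}
    (x : Mod × (Fin T → Round Dec Unit unitInterval)) : 0 ≤ hitCount arm x :=
  Finset.sum_nonneg fun _ _ => hit_nonneg arm _

theorem hitCount_le (arm : Mod ≃ Dec) {T : ℕ}
    (x : Mod × (Fin T → Round Dec Unit unitInterval)) : hitCount arm x ≤ T :=
  (Finset.sum_le_sum fun _ _ => hit_le_one arm _).trans_eq (by simp)

theorem sum_hitCount [Fintype Mod] (arm : Mod ≃ Dec) {T : ℕ}
    (h : Fin T → Round Dec Unit unitInterval) :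
    ∑ m, hitCount arm (m, h) = T := by
  simp only [hitCount]
  rw [Finset.sum_comm]
  simp [sum_hit]

theorem measurable_round [MeasurableSpace Dec] [MeasurableSpace Mod] {T : ℕ} (t : Fin T) :
    Measurable fun x : Mod × (Fin T → Round Dec Unit unitInterval) => (x.1, x.2 t) := by
  fun_prop

/-- A comparison of the distance in variation with the relative entropy, in pointwise form. -/
theorem abs_sub_one_le_log {x : ℝ} (hx : 0 < x) :
    |x - 1| ≤ 8 * (x - 1 - Real.log x) + (x + 1) / 16 := by
  obtain ⟨s, hs, rfl⟩ : ∃ s : ℝ, 0 < s ∧ s ^ 2 = x :=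
    ⟨√x, Real.sqrt_pos.2 hx, Real.sq_sqrt hx.le⟩
  have hlog : Real.log (s ^ 2) ≤ 2 * (s - 1) := by
    rw [Real.log_pow]
    push_cast
    linarith [Real.log_le_sub_one_of_pos hs]
  -- By the previous bound `s ^ 2 - 1 - log (s ^ 2)` is at least `(s - 1) ^ 2`; what remains is the
  -- inequality of the means for the two factors of `s ^ 2 - 1`.
  rw [abs_le]
  constructor
  · nlinarith [sq_nonneg (16 * (s - 1) + (s + 1)), sq_nonneg (s - 1)]
  · nlinarith [sq_nonneg (16 * (s - 1) - (s + 1)), sq_nonneg (s - 1)]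

end HiddenArm

section HiddenArm

variable {Dec Mod : Type*} [Fintype Mod] [MeasurableSpace Mod] [DiscreteMeasurableSpace Mod]
  [Countable Dec] [MeasurableSpace Dec] [DiscreteMeasurableSpace Dec]

theorem measurable_hit (arm : Mod ≃ Dec) : Measurable (hit arm) := Measurable.of_discrete

theorem measurable_hit_round (arm : Mod ≃ Dec) :
    Measurable fun x : Mod × Round Dec Unit unitInterval => hit arm (x.1, x.2.1.2) :=
  (measurable_hit arm).comp (by fun_prop)

theorem measurable_likelihood (arm : Mod ≃ Dec) (ε : ℝ) : Measurable (likelihood arm ε) := by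
  have := measurable_hit_round (Mod := Mod) arm
  unfold likelihood
  fun_prop

theorem measurable_hitCount (arm : Mod ≃ Dec) {T : ℕ} :
    Measurable (hitCount arm : Mod × (Fin T → Round Dec Unit unitInterval) → ℝ) :=
  Finset.measurable_sum _ fun t _ => (measurable_hit_round arm).comp (measurable_round t)

theorem integrable_hitCount (arm : Mod ≃ Dec) {T : ℕ}
    (μ : Measure (Mod × (Fin T → Round Dec Unit unitInterval))) [IsFiniteMeasure μ] :
    Integrable (hitCount arm) μ :=
  Integrable.of_bound (measurable_hitCount arm).aestronglyMeasurable T <|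
    Filter.Eventually.of_forall fun x => by
      rw [Real.norm_of_nonneg (hitCount_nonneg arm x)]
      exact hitCount_le arm x

variable [Nonempty Mod] (arm : Mod ≃ Dec) {ε : ℝ} (hε : ε ∈ Set.Icc (0 : ℝ) (1 / 4))

/-- The Bernoulli bandit in which one decision, uniformly distributed under the prior, has a mean
reward that is larger by `ε` than that of all the others. -/
def hiddenArmTask : Task Dec Mod Unit unitInterval :=
  bernoulliTask (PMF.uniformOfFintype Mod).toMeasure (hiddenMean arm hε) Measurable.of_discrete

variable (Dec) in
/-- The bandit with a single model in which all the rewards are fair coin flips. -/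
def fairTask : Task Dec Unit Unit unitInterval :=
  bernoulliTask (Measure.dirac ()) (fun _ => ⟨1 / 2, by norm_num, by norm_num⟩) measurable_const

/-- The prior of the hidden-arm bandit together with the law of independent play against fair coin
flips. -/
def fairLaw (Mod : Type*) [Fintype Mod] [MeasurableSpace Mod] [Nonempty Mod]
    (A : Algorithm Dec Unit unitInterval) (T : ℕ) :
    Measure (Mod × (Fin T → Round Dec Unit unitInterval)) :=
  (PMF.uniformOfFintype Mod).toMeasure.prod (playLaw (fairTask Dec) A T)

instance isProbabilityMeasure_fairLaw (A : Algorithm Dec Unit unitInterval) (T : ℕ) :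
    IsProbabilityMeasure (fairLaw Mod A T) := by
  unfold fairLaw
  infer_instance

theorem hiddenArmTask_optimalReward (m : Mod) (c : Unit) :
    (hiddenArmTask arm hε).optimalReward m c = 1 / 2 + ε := by
  have hmean : ∀ π, (hiddenArmTask arm hε).meanReward m π c = 1 / 2 + ε * hit arm (m, π) :=
    fun π => bernoulliTask_meanReward _ _ m π c
  have hle : ∀ π, (hiddenArmTask arm hε).meanReward m π c ≤ 1 / 2 + ε := fun π => by
    rw [hmean]
    nlinarith [hε.1, hit_le_one arm (m, π)]
  have : Nonempty Dec := ⟨arm m⟩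
  refine le_antisymm (ciSup_le hle) ?_
  refine le_trans ?_ (le_ciSup (f := fun π => (hiddenArmTask arm hε).meanReward m π c)
    ⟨1 / 2 + ε, Set.forall_mem_range.2 hle⟩ (arm m))
  simp [hmean, hit_self]

/-- The regret is `ε` times the expected number of rounds in which the good decision is missed. -/
theorem bayesianRegret_hiddenArmTask (A : Algorithm Dec Unit unitInterval) (T : ℕ) :
    bayesianRegret (hiddenArmTask arm hε) A T =
      ε * (T - ∫ x, hitCount arm x ∂gameLaw (hiddenArmTask arm hε) A T) := by
  have hg : Measurable fun x : Mod × Round Dec Unit unitInterval =>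
      1 / 2 + ε * hit arm (x.1, x.2.1.2) - (x.2.2.2 : ℝ) := by
    have := measurable_hit_round (Mod := Mod) arm
    fun_prop
  have hbound : ∀ x : Mod × Round Dec Unit unitInterval,
      ‖1 / 2 + ε * hit arm (x.1, x.2.1.2) - (x.2.2.2 : ℝ)‖ ≤ 1 := fun x => by
    have hp := (hiddenMean arm hε (x.1, x.2.1.2)).2
    simp only [hiddenMean, Set.mem_Icc] at hp
    rw [Real.norm_eq_abs, abs_le]
    constructor <;> linarith [x.2.2.2.2.1, x.2.2.2.2.2]
  have hzero := integral_sum_eq_zero (hiddenArmTask arm hε) A T hg hbound fun m c π => by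
    rw [hiddenArmTask, bernoulliTask_feedback, integral_coin]
    simp [hiddenMean]
    ring
  have hsum : ∀ x : Mod × (Fin T → Round Dec Unit unitInterval),
      ∑ t, (1 / 2 + ε - ((x.2 t).2.2 : ℝ)) =
        (∑ t, (1 / 2 + ε * hit arm (x.1, (x.2 t).1.2) - ((x.2 t).2.2 : ℝ))) +
          ε * (T - hitCount arm x) := fun x => by
    simp only [hitCount, Finset.sum_sub_distrib, Finset.sum_add_distrib, ← Finset.mul_sum,
      Finset.sum_const, Finset.card_univ, Fintype.card_fin, nsmul_eq_mul]
    ring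
  have hN := integrable_hitCount arm (gameLaw (hiddenArmTask arm hε) A T)
  simp only [bayesianRegret, hiddenArmTask_optimalReward, hsum]
  rw [integral_add, hzero, zero_add, integral_const_mul, integral_sub (integrable_const _) hN]
  · simp
  · refine Integrable.of_bound (Measurable.aestronglyMeasurable ?_) (T * 1)
      (Filter.Eventually.of_forall fun x => (norm_sum_le_of_le _ fun t _ =>
        hbound (x.1, x.2 t)).trans_eq (by simp))
    exact Finset.measurable_sum _ fun t _ => hg.comp (measurable_round t)
  · exact ((integrable_const _).sub hN).const_mul ε

theorem gameLaw_hiddenArmTask (A : Algorithm Dec Unit unitInterval) (T : ℕ) :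
    gameLaw (hiddenArmTask arm hε) A T =
      (fairLaw Mod A T).withDensity
        fun x => ENNReal.ofReal (∏ t, likelihood arm ε (x.1, x.2 t)) := by
  have hpos : ∀ x, 0 ≤ likelihood arm ε x := fun x => by
    linarith [(likelihood_mem_Icc arm hε x).1]
  simp only [ENNReal.ofReal_prod_of_nonneg fun t _ => hpos _]
  exact gameLaw_eq_withDensity (τ₀ := fairTask Dec) A (measurable_likelihood arm ε).ennreal_ofReal
    (fun m => rfl) (fun m c π => coin_hiddenMean_eq_withDensity arm hε rfl m c π) T

/-- Independently of the play, the good decision is uniformly distributed under the prior. -/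
theorem integral_hitCount_fairLaw (A : Algorithm Dec Unit unitInterval) (T : ℕ) :
    ∫ x, hitCount arm x ∂fairLaw Mod A T = T / Fintype.card Mod := by
  rw [fairLaw, integral_prod_symm _ (integrable_hitCount arm _)]
  simp only [PMF.integral_eq_sum, PMF.uniformOfFintype_apply, ENNReal.toReal_inv,
    ENNReal.toReal_natCast, smul_eq_mul, ← Finset.mul_sum, sum_hitCount]
  simp [div_eq_inv_mul]

/-- The chain rule for the relative entropy of the game with fair coin flips with respect to the
hidden-arm bandit: only the rounds in which the good decision is taken contribute. -/
theorem integral_sum_log_likelihood (hε : ε ∈ Set.Icc (0 : ℝ) (1 / 4))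
    (A : Algorithm Dec Unit unitInterval) (T : ℕ) :
    ∫ x, ∑ t, Real.log (likelihood arm ε (x.1, x.2 t)) ∂fairLaw Mod A T =
      -(coinEntropy ε * (T / Fintype.card Mod)) := by
  have hlog : Measurable fun x => Real.log (likelihood arm ε x) :=
    (measurable_likelihood arm ε).log
  have hlogsum : Integrable (fun x => ∑ t, Real.log (likelihood arm ε (x.1, x.2 t)))
      (fairLaw Mod A T) := by
    refine Integrable.of_bound (Finset.measurable_sum _ fun t _ =>
      hlog.comp (measurable_round t)).aestronglyMeasurable (T * 1)
      (Filter.Eventually.of_forall fun x => (norm_sum_le_of_le _ fun t _ =>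
        abs_log_likelihood_le arm hε (x.1, x.2 t)).trans_eq (by simp))
  have hN := (integrable_hitCount arm (fairLaw Mod A T)).const_mul (coinEntropy ε)
  have hzero : ∫ x, ((∑ t, Real.log (likelihood arm ε (x.1, x.2 t))) +
      coinEntropy ε * hitCount arm x) ∂fairLaw Mod A T = 0 := by
    refine (integral_prod _ (hlogsum.add hN)).trans ?_
    refine integral_eq_zero_of_ae (Filter.Eventually.of_forall fun m => ?_)
    have hgm : Measurable fun y : Round Dec Unit unitInterval =>
        Real.log (likelihood arm ε (m, y)) + coinEntropy ε * hit arm (m, y.1.2) :=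
      (hlog.comp measurable_prodMk_left).add
        (((measurable_hit_round arm).comp measurable_prodMk_left).const_mul _)
    have hbound : ∀ y : Round Dec Unit unitInterval,
        ‖Real.log (likelihood arm ε (m, y)) + coinEntropy ε * hit arm (m, y.1.2)‖ ≤
          1 + |coinEntropy ε| := fun y => by
      refine (norm_add_le _ _).trans (add_le_add (abs_log_likelihood_le arm hε _) ?_)
      rw [norm_mul, Real.norm_of_nonneg (hit_nonneg arm _)]
      exact mul_le_of_le_one_right (norm_nonneg _) (hit_le_one arm _)
    have key := integral_sum_eq_zero (fairTask Dec) A T (hgm.comp measurable_snd)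
      (fun x => hbound x.2) fun _ c π => integral_log_likelihood arm ε rfl m c π
    have hmeas : Measurable fun h : Fin T → Round Dec Unit unitInterval =>
        ∑ t, (Real.log (likelihood arm ε (m, h t)) + coinEntropy ε * hit arm (m, (h t).1.2)) :=
      Finset.measurable_sum _ fun t _ => hgm.comp (measurable_pi_apply t)
    have hplay := (integral_map (μ := gameLaw (fairTask Dec) A T) measurable_snd.aemeasurable
      hmeas.aestronglyMeasurable).trans key
    simpa only [playLaw, Pi.add_apply, Pi.zero_apply, hitCount, Finset.mul_sum,
      ← Finset.sum_add_distrib] using hplay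
  rw [integral_add hlogsum hN, integral_const_mul, integral_hitCount_fairLaw] at hzero
  linarith

/-- Against fair coin flips the good decision is taken in a fraction `1 / Fintype.card Mod` of the
rounds; the actual game cannot do much better as long as its relative entropy is small. -/
theorem integral_hitCount_gameLaw_le (A : Algorithm Dec Unit unitInterval) (T : ℕ) :
    ∫ x, hitCount arm x ∂gameLaw (hiddenArmTask arm hε) A T ≤
      T / Fintype.card Mod + T * (8 * (4 * ε ^ 2 * (T / Fintype.card Mod)) + 1 / 8) := by
  set L : Mod × (Fin T → Round Dec Unit unitInterval) → ℝ :=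
    fun x => ∏ t, likelihood arm ε (x.1, x.2 t)
  set μ := fairLaw Mod A T
  have hpos : ∀ x, 0 < likelihood arm ε x := fun x => by
    linarith [(likelihood_mem_Icc arm hε x).1]
  have hLpos : ∀ x, 0 < L x := fun x => Finset.prod_pos fun t _ => hpos _
  have hLm : Measurable L := Finset.measurable_prod _ fun t _ =>
    (measurable_likelihood arm ε).comp (measurable_round t)
  have hLle : ∀ x, L x ≤ 2 ^ T := fun x => by
    refine (Finset.prod_le_prod (fun t _ => (hpos _).le) fun t _ =>
      (likelihood_mem_Icc arm hε (x.1, x.2 t)).2).trans_eq (by simp)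
  have hLI : Integrable L μ := Integrable.of_bound hLm.aestronglyMeasurable (2 ^ T)
    (Filter.Eventually.of_forall fun x => by
      rw [Real.norm_of_nonneg (hLpos x).le]
      exact hLle x)
  have hlog : ∀ x, Real.log (L x) = ∑ t, Real.log (likelihood arm ε (x.1, x.2 t)) := fun x =>
    Real.log_prod fun t _ => (hpos _).ne'
  have hlogI : Integrable (fun x => Real.log (L x)) μ :=
    Integrable.of_bound hLm.log.aestronglyMeasurable (T * 1)
      (Filter.Eventually.of_forall fun x => by
        rw [hlog]
        exact (norm_sum_le_of_le _ fun t _ =>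
          abs_log_likelihood_le arm hε (x.1, x.2 t)).trans_eq (by simp))
  have hchange : ∀ f : Mod × (Fin T → Round Dec Unit unitInterval) → ℝ,
      ∫ x, f x ∂gameLaw (hiddenArmTask arm hε) A T = ∫ x, L x * f x ∂μ := fun f => by
    rw [gameLaw_hiddenArmTask, integral_withDensity_eq_integral_toReal_smul hLm.ennreal_ofReal
      (Filter.Eventually.of_forall fun _ => ENNReal.ofReal_lt_top)]
    exact integral_congr_ae (Filter.Eventually.of_forall fun x => by
      change (ENNReal.ofReal (L x)).toReal * f x = L x * f x
      rw [ENNReal.toReal_ofReal (hLpos x).le])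
  have hLone : ∫ x, L x ∂μ = 1 := by
    have := hchange fun _ => 1
    simpa using this.symm
  have hlogL : ∫ x, Real.log (L x) ∂μ = -(coinEntropy ε * (T / Fintype.card Mod)) := by
    simp only [hlog]
    exact integral_sum_log_likelihood arm hε A T
  have hN := integrable_hitCount arm μ
  have hNL : Integrable (fun x => L x * hitCount arm x) μ :=
    Integrable.of_bound (hLm.mul (measurable_hitCount arm)).aestronglyMeasurable (2 ^ T * T)
      (Filter.Eventually.of_forall fun x => by
        rw [Real.norm_of_nonneg (mul_nonneg (hLpos x).le (hitCount_nonneg arm x))]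
        exact mul_le_mul (hLle x) (hitCount_le arm x) (hitCount_nonneg arm x) (by positivity))
  have hE₁ : Integrable (fun x => L x - 1) μ := hLI.sub (integrable_const 1)
  have hE₂ : Integrable (fun x => L x - 1 - Real.log (L x)) μ := hE₁.sub hlogI
  have hE₃ : Integrable (fun x => L x + 1) μ := hLI.add (integrable_const 1)
  have hE : Integrable (fun x => 8 * (L x - 1 - Real.log (L x)) + (L x + 1) / 16) μ :=
    (hE₂.const_mul 8).add (hE₃.div_const 16)
  have hpoint : ∀ x, L x * hitCount arm x ≤
      hitCount arm x + T * (8 * (L x - 1 - Real.log (L x)) + (L x + 1) / 16) := fun x => by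
    have h1 : hitCount arm x * (L x - 1) ≤ T * |L x - 1| :=
      (mul_le_mul_of_nonneg_left (le_abs_self _) (hitCount_nonneg arm x)).trans
        (mul_le_mul_of_nonneg_right (hitCount_le arm x) (abs_nonneg _))
    have h2 := mul_le_mul_of_nonneg_left (abs_sub_one_le_log (hLpos x)) (Nat.cast_nonneg (α := ℝ) T)
    linarith
  have hEval : ∫ x, (8 * (L x - 1 - Real.log (L x)) + (L x + 1) / 16) ∂μ =
      8 * (coinEntropy ε * (T / Fintype.card Mod)) + 1 / 8 := by
    rw [integral_add (hE₂.const_mul 8) (hE₃.div_const 16), integral_const_mul, integral_div,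
      integral_sub hE₁ hlogI, integral_sub hLI (integrable_const 1),
      integral_add hLI (integrable_const 1), hLone, hlogL]
    simp
    norm_num
  have hκ := mul_le_mul_of_nonneg_right (coinEntropy_le hε)
    (show (0 : ℝ) ≤ T / Fintype.card Mod by positivity)
  calc ∫ x, hitCount arm x ∂gameLaw (hiddenArmTask arm hε) A T
      = ∫ x, L x * hitCount arm x ∂μ := hchange _
    _ ≤ ∫ x, (hitCount arm x + T * (8 * (L x - 1 - Real.log (L x)) + (L x + 1) / 16)) ∂μ :=
        integral_mono hNL (hN.add (hE.const_mul _)) hpoint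
    _ = T / Fintype.card Mod + T * (8 * (coinEntropy ε * (T / Fintype.card Mod)) + 1 / 8) := by
        rw [integral_add hN (hE.const_mul _), integral_const_mul, hEval,
          integral_hitCount_fairLaw]
    _ ≤ _ := by gcongr

end HiddenArm

/-! ### The linear bandit on an orthonormal basis -/

section Linear

/-- The parameter vector with all the coordinates `1 / 2`, except that the coordinate `j` is
`1 / 2 + ε`. -/
def hiddenVector (d : ℕ) (ε : ℝ) (j : Fin d) : EuclideanSpace ℝ (Fin d) :=
  WithLp.toLp 2 (fun _ => 1 / 2) + EuclideanSpace.single j ε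

theorem inner_hiddenVector (d : ℕ) (ε : ℝ) (j i : Fin d) :
    inner ℝ (hiddenVector d ε j) (EuclideanSpace.single i (1 : ℝ)) =
      1 / 2 + if j = i then ε else 0 := by
  rw [EuclideanSpace.inner_single_right]
  simp [hiddenVector, eq_comm]

theorem hiddenVector_injective (d : ℕ) {ε : ℝ} (hε : ε ≠ 0) :
    Function.Injective (hiddenVector d ε) := by
  intro j k hjk
  by_contra hne
  have h := congrArg (fun v => inner ℝ v (EuclideanSpace.single k (1 : ℝ))) hjk
  simp [inner_hiddenVector, hne] at h
  exact hε h

theorem single_one_injective (d : ℕ) :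
    Function.Injective fun i : Fin d => EuclideanSpace.single i (1 : ℝ) := by
  intro i j hij
  by_contra hne
  have h := congrArg (fun v => v.ofLp i) hij
  simp [hne] at h

end Linear

end BayesDecision

end

theorem mainTheorem8 :
    ∃ c : ℝ, 0 < c ∧ ∀ d T : ℕ, 2 ≤ d → d ≤ T →
      ∃ (D Θ : Set (EuclideanSpace ℝ (Fin d))) (τ : BayesDecision.Task D Θ Unit unitInterval),
        D ⊆ Metric.closedBall 0 1 ∧ D.Nonempty ∧ IsCompact D ∧ IsCompact Θ ∧
        BayesDecision.IsLinearBandit τ ∧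
        ∀ A : BayesDecision.Algorithm D Unit unitInterval,
          c * √((d : ℝ) * (T : ℝ)) ≤ BayesDecision.bayesianRegret τ A T := by
  refine ⟨1 / 64, by norm_num, fun d T hd hT => ?_⟩
  have hd0 : (0 : ℝ) < d := by exact_mod_cast (by omega : 0 < d)
  have hT0 : (0 : ℝ) < T := by exact_mod_cast (by omega : 0 < T)
  have hd2 : (2 : ℝ) ≤ d := by exact_mod_cast hd
  -- With this gap the relative entropy of the game is at most a small constant.
  set ε : ℝ := √(d / T) / 16 with hεdef
  have hε0 : 0 < ε := by positivity
  have hsqrt : √((d : ℝ) / T) ≤ 1 :=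
    Real.sqrt_le_iff.2 ⟨zero_le_one, by rw [one_pow, div_le_one hT0]; exact_mod_cast hT⟩
  have hε : ε ∈ Set.Icc (0 : ℝ) (1 / 4) := ⟨hε0.le, by linarith⟩
  have hε2 : ε ^ 2 = d / T / 256 := by
    rw [hεdef, div_pow, Real.sq_sqrt (by positivity)]
    norm_num
  have hεT : ε * T = √(d * T) / 16 := by
    have : √((d : ℝ) / T) * T = √(d * T) := by
      rw [Real.sqrt_div hd0.le, Real.sqrt_mul hd0.le, div_mul_eq_mul_div,
        div_eq_iff (by positivity), mul_assoc, Real.mul_self_sqrt hT0.le]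
    rw [hεdef, ← this]
    ring
  have hv := BayesDecision.hiddenVector_injective d hε0.ne'
  have he := BayesDecision.single_one_injective d
  let D : Set (EuclideanSpace ℝ (Fin d)) :=
    Set.range fun i : Fin d => EuclideanSpace.single i (1 : ℝ)
  let Θ : Set (EuclideanSpace ℝ (Fin d)) := Set.range (BayesDecision.hiddenVector d ε)
  have hDfin : D.Finite := Set.finite_range _
  have hΘfin : Θ.Finite := Set.finite_range _
  have : Finite D := hDfin
  have : Nonempty Θ := ⟨⟨_, ⟨⟨0, by omega⟩, rfl⟩⟩⟩
  let _ : Fintype Θ := hΘfin.fintype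
  let arm : Θ ≃ D := (Equiv.ofInjective _ hv).symm.trans (Equiv.ofInjective _ he)
  have hcard : Fintype.card Θ = d := by
    rw [Fintype.card_congr (Equiv.ofInjective _ hv).symm, Fintype.card_fin]
  refine ⟨D, Θ, BayesDecision.hiddenArmTask arm hε, ?_, ⟨_, ⟨⟨0, by omega⟩, rfl⟩⟩,
    hDfin.isCompact, hΘfin.isCompact, ⟨?_, ?_⟩, fun A => ?_⟩
  · rintro _ ⟨i, rfl⟩
    simp
  · intro θ π c
    obtain ⟨j, rfl⟩ := (Equiv.ofInjective _ hv).surjective θ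
    obtain ⟨i, rfl⟩ := (Equiv.ofInjective _ he).surjective π
    refine (BayesDecision.bernoulliTask_meanReward _ _ _ _ _).trans ?_
    refine Eq.trans ?_ (BayesDecision.inner_hiddenVector d ε j i).symm
    have harm : arm (Equiv.ofInjective _ hv j) = Equiv.ofInjective _ he i ↔ j = i := by
      simp only [arm, Equiv.trans_apply, Equiv.symm_apply_apply, EmbeddingLike.apply_eq_iff_eq]
    simp only [BayesDecision.hiddenMean, BayesDecision.hit, harm, mul_ite, mul_one, mul_zero]
  · exact BayesDecision.bernoulliTask_obs_eq_reward _ _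
  · have hN := BayesDecision.integral_hitCount_gameLaw_le arm hε A T
    have hKL : 4 * ε ^ 2 * (T / d) = 1 / 64 := by
      rw [hε2]
      field_simp
      norm_num
    have hdT : (T : ℝ) / d ≤ T / 2 := by gcongr
    rw [hcard, hKL] at hN
    rw [BayesDecision.bayesianRegret_hiddenArmTask]
    calc 1 / 64 * √((d : ℝ) * T) = ε * (T - 3 / 4 * T) := by linarith
      _ ≤ _ := by
        refine mul_le_mul_of_nonneg_left ?_ hε0.le
        linarith
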